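/- Let $m,n\ge 1$, let $s_1,\dots,s_m\ge 1$ and $t_1,\dots,t_n\ge 0$ be integers, and let $G$ be a Cameron–Walker graph in its standard labeled form, that is, a finite simple graph obtained from a connected bipartite graph with vertex partition $\{v_1,\dots,v_m\}\sqcup\{w_1,\dots,w_n\}$ by attaching to each $v_i$ exactly $s_i$ leaves $x^{(i)}_1,\dots,x^{(i)}_{s_i}$ (each joined to $v_i$ only) and to each $w_j$ exactly $t_j$ pendant triangles with vertices $w_j,\,y^{(j)}_{\ell,1},\,y^{(j)}_{\ell,2}$, $1\le \ell\le t_j$ (where $y^{(j)}_{\ell,1},y^{(j)}_{\ell,2}$ have no other neighbours than each other and $w_j$). Let $K$ be a field, $S=K[V(G)]$ the polynomial ring in the vertices of $G$ with the standard grading, $I(G)=(ab : \{a,b\}\in E(G))\subset S$ the edge ideal of $G$, $d=\dim S/I(G)$ the Krull dimension, and let $h(S/I(G),\lambda)\in\mathbb Z[\lambda]$ be the $h$-polynomial, i.e. the polynomial with $$\sum_{i\ge 0}\dim_K (S/I(G))_i\,\lambda^i=\frac{h(S/I(G),\lambda)}{(1-\lambda)^{d}}.$$ Then $$\deg h(S/I(G),\lambda)=\dim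 S/I(G)=\sum_{i=1}^m s_i+\sum_{j=1}^n\max\{t_j,1\}.$$ -/

import Mathlib

noncomputable section

/-- The edge ideal `I(G) = (x_a x_b : {a, b} ∈ E(G))` of `K[V(G)]`. -/
def edgeIdeal (K : Type*) [Field K] {V : Type*} (G : SimpleGraph V) :
    Ideal (MvPolynomial V K) :=
  Ideal.span {p | ∃ a b : V, G.Adj a b ∧ p = MvPolynomial.X a * MvPolynomial.X b}

/-- The degree `i` piece `(S/I)_i` of `S/I`, for a homogeneous ideal `I` of the standard graded
polynomial ring `S = K[σ]`: the image of the forms of degree `i`. -/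
def quotientPiece {K σ : Type*} [Field K] (I : Ideal (MvPolynomial σ K)) (i : ℕ) :
    Submodule K (MvPolynomial σ K ⧸ I) :=
  (MvPolynomial.homogeneousSubmodule σ K i).map (Ideal.Quotient.mkₐ K I).toLinearMap

/-- The Hilbert series `H(S/I, λ) = ∑ i, dim_K (S/I)_i λ^i`. -/
def hilbertSeries {K σ : Type*} [Field K] (I : Ideal (MvPolynomial σ K)) : PowerSeries ℤ :=
  PowerSeries.mk fun i => (Module.finrank K (quotientPiece I i) : ℤ)

/-- `h` is the `h`-polynomial of `S/I`: `H(S/I, λ) = h(λ) / (1 - λ)^d` with `d = dim S/I`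
(Krull dimension). -/
def IsHPolynomial {K σ : Type*} [Field K] (I : Ideal (MvPolynomial σ K)) (h : Polynomial ℤ) :
    Prop :=
  ∃ d : ℕ, ringKrullDim (MvPolynomial σ K ⧸ I) = d ∧
    (h : PowerSeries ℤ) = (1 - PowerSeries.X) ^ d * hilbertSeries I

/-- There is at most one `h`-polynomial. -/
theorem IsHPolynomial.unique {K σ : Type*} [Field K] {I : Ideal (MvPolynomial σ K)}
    {h h' : Polynomial ℤ} (H : IsHPolynomial I h) (H' : IsHPolynomial I h') : h = h' := by
  obtain ⟨d, hd, e⟩ := H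
  obtain ⟨d', hd', e'⟩ := H'
  have hdd : d = d' := by
    rw [hd] at hd'
    exact_mod_cast hd'
  subst hdd
  exact Polynomial.coe_injective ℤ (e.trans e'.symm)

/-- The vertices of a Cameron–Walker graph in the standard labeling (indices start at `0`):
leaves `x i k` for `k < s i`, the two sides `v i` and `w j` of the bipartite part, and
`y j l 0`, `y j l 1` for `l < t j`. -/
inductive CWVertex {m n : ℕ} (s : Fin m → ℕ) (t : Fin n → ℕ) : Type
  | x (i : Fin m) (k : Fin (s i)) : CWVertex s t
  | v (i : Fin m) : CWVertex s t
  | w (j : Fin n) : CWVertex s t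
  | y (j : Fin n) (l : Fin (t j)) (b : Fin 2) : CWVertex s t

/-- The edges (each listed in one orientation): those of the bipartite graph `B`, the leaf edges
`{v i, x i k}`, and the sides of the pendant triangles `{w j, y j l 0, y j l 1}`. -/
inductive CWEdge {m n : ℕ} (s : Fin m → ℕ) (t : Fin n → ℕ) (B : SimpleGraph (Fin m ⊕ Fin n)) :
    CWVertex s t → CWVertex s t → Prop
  | bipartite (i : Fin m) (j : Fin n) (h : B.Adj (Sum.inl i) (Sum.inr j)) :
      CWEdge s t B (CWVertex.v i) (CWVertex.w j)
  | leaf (i : Fin m) (k : Fin (s i)) : CWEdge s t B (CWVertex.v i) (CWVertex.x i k)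
  | side (j : Fin n) (l : Fin (t j)) (b : Fin 2) :
      CWEdge s t B (CWVertex.w j) (CWVertex.y j l b)
  | base (j : Fin n) (l : Fin (t j)) :
      CWEdge s t B (CWVertex.y j l 0) (CWVertex.y j l 1)

/-- The graph obtained from a bipartite graph `B` with sides `v_1, …, v_m` and `w_1, …, w_n` by
attaching `s i` leaves to each `v_i` and `t j` pendant triangles to each `w_j`. -/
def cameronWalkerGraph {m n : ℕ} (s : Fin m → ℕ) (t : Fin n → ℕ)
    (B : SimpleGraph (Fin m ⊕ Fin n)) : SimpleGraph (CWVertex s t) :=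
  SimpleGraph.fromRel (CWEdge s t B)

end

/-!
For a finite graph `G`, the monomials with independent support form a basis of `S / I(G)`
(`finrank_quotientPiece_edgeIdeal`), so the Hilbert series is the sum of `(λ / (1 - λ)) ^ |A|` over
the independent sets `A`. The Krull dimension is the independence number `d`: a prime containing
`I(G)` contains the variables of a vertex cover, hence lies over a polynomial ring in the variables
of an independent set. Therefore `h = ∑ λ ^ |A| (1 - λ) ^ (d - |A|)`, a polynomial of degree at most
`d` whose coefficient at `λ ^ d` is `∑ (-1) ^ (d - |A|)`. This coefficient has the parity of the
number of independent sets, so `deg h = d` as soon as that number is odd.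

For a Cameron–Walker graph two involutions show that it is odd. Toggling a leaf at some `v i ∉ A`
pairs up the independent sets missing some `v i` (`even_card_indepSets_missing`). An independent set
containing all `v i` contains no leaf and, every `w j` having a neighbour `v i`, no `w j`; exchanging
the two free vertices in each triangle pairs up these sets, except for `{v i}` itself
(`odd_card_indepSets_full`).

The independence number is computed from the map `CWVertex.toCell`, whose fibres are cliques and
which has a section with independent image.
-/

/-! ### Independent sets -/

/-- The finite set of independent vertex sets of a finite graph. -/
noncomputable def indepSets {V : Type*} [Fintype V] (G : SimpleGraph V) : Finset (Finset V) := by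
  classical exact Finset.univ.filter fun A => G.IsIndepSet (A : Set V)

@[simp]
theorem mem_indepSets {V : Type*} [Fintype V] {G : SimpleGraph V} {A : Finset V} :
    A ∈ indepSets G ↔ G.IsIndepSet (A : Set V) := by
  simp [indepSets]

section

open MvPolynomial

/-! ### The Krull dimension of an edge ideal -/

/-- An edge ideal is a monomial ideal: a polynomial lies in it iff none of its monomials has
independent support. -/
theorem mem_edgeIdeal_iff {K V : Type*} [Field K] (G : SimpleGraph V) (p : MvPolynomial V K) :
    p ∈ edgeIdeal K G ↔ ∀ m ∈ p.support, ¬ G.IsIndepSet (m.support : Set V) := by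
  classical
  have h : edgeIdeal K G = Ideal.span ((fun m => monomial m (1 : K)) ''
      {m | ∃ a b, G.Adj a b ∧ m = Finsupp.single a 1 + Finsupp.single b 1}) := by
    unfold edgeIdeal
    congr 1
    ext p
    constructor
    · rintro ⟨a, b, hab, rfl⟩
      exact ⟨_, ⟨a, b, hab, rfl⟩, by simp [X, monomial_mul]⟩
    · rintro ⟨_, ⟨a, b, hab, rfl⟩, rfl⟩
      exact ⟨a, b, hab, by simp [X, monomial_mul]⟩
  rw [h, mem_ideal_span_monomial_image]
  refine forall₂_congr fun m _ => ?_
  constructor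
  · rintro ⟨_, ⟨a, b, hab, rfl⟩, hle⟩ hind
    have ha : m a ≠ 0 := by
      have := hle a
      simp only [Finsupp.add_apply, Finsupp.single_eq_same] at this
      omega
    have hb : m b ≠ 0 := by
      have := hle b
      simp only [Finsupp.add_apply, Finsupp.single_eq_same] at this
      omega
    exact hind (by simpa using ha) (by simpa using hb) hab.ne hab
  · intro hind
    simp only [SimpleGraph.isIndepSet_iff, Set.Pairwise] at hind
    push Not at hind
    obtain ⟨a, ha, b, hb, hne, hab⟩ := hind
    refine ⟨_, ⟨a, b, hab, rfl⟩, fun c => ?_⟩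
    have ha' : m a ≠ 0 := by simpa using ha
    have hb' : m b ≠ 0 := by simpa using hb
    simp only [Finsupp.add_apply, Finsupp.single_apply]
    split_ifs with h₁ h₂ h₂
    · exact absurd (h₁.trans h₂.symm) hne
    · subst h₁; omega
    · subst h₂; omega
    · omega

/-- Killing all variables outside `A` leaves a polynomial ring in the variables of `A`. -/
theorem ringKrullDim_quotient_span_X_compl_le (K : Type*) [Field K] {V : Type*} (A : Finset V) :
    ringKrullDim (MvPolynomial V K ⧸ Ideal.span ((X : V → MvPolynomial V K) '' {v | v ∉ A})) ≤
      (A.card : WithBot ℕ∞) := by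
  set J := Ideal.span ((X : V → MvPolynomial V K) '' {v | v ∉ A})
  let f : MvPolynomial A K →ₐ[K] MvPolynomial V K ⧸ J :=
    aeval fun a => Ideal.Quotient.mk J (X (a : V))
  have hf : Function.Surjective f := by
    have hle : (⊤ : Subalgebra K (MvPolynomial V K)) ≤
        f.range.comap (Ideal.Quotient.mkₐ K J) := by
      rw [← adjoin_range_X, Algebra.adjoin_le_iff]
      rintro _ ⟨v, rfl⟩
      by_cases hv : v ∈ A
      · exact ⟨X ⟨v, hv⟩, by simp [f]⟩
      · refine ⟨0, ?_⟩
        have : Ideal.Quotient.mk J (X v) = 0 :=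
          Ideal.Quotient.eq_zero_iff_mem.2 (Ideal.subset_span ⟨v, hv, rfl⟩)
        simp [this]
    intro q
    obtain ⟨p, rfl⟩ := Ideal.Quotient.mk_surjective q
    exact hle (Algebra.mem_top (x := p))
  refine (ringKrullDim_le_of_surjective f.toRingHom hf).trans ?_
  rw [MvPolynomial.ringKrullDim_of_isNoetherianRing, ringKrullDim_eq_zero_of_field]
  simp

/-- A prime containing the edge ideal contains the variables of a vertex cover, so every chain of
such primes lives over the complementary independent set. -/
theorem ringKrullDim_edgeIdeal_le (K : Type*) [Field K] {V : Type*} [Fintype V]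
    (G : SimpleGraph V) {d : ℕ} (hd : ∀ A : Finset V, G.IsIndepSet A → A.card ≤ d) :
    ringKrullDim (MvPolynomial V K ⧸ edgeIdeal K G) ≤ d := by
  classical
  rw [ringKrullDim_quotient, Order.krullDim]
  refine iSup_le fun l => ?_
  set P := l.head.1.asIdeal with hP
  have hPrime : P.IsPrime := l.head.1.isPrime
  let A : Finset V := Finset.univ.filter fun v => X v ∉ P
  have hA : G.IsIndepSet A := by
    intro a ha b hb _ hab
    have hmem : (X a * X b : MvPolynomial V K) ∈ P :=
      l.head.2 (Ideal.subset_span ⟨a, b, hab, rfl⟩)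
    rcases hPrime.mem_or_mem hmem with h | h
    · simp [A, h] at ha
    · simp [A, h] at hb
  set J := Ideal.span ((X : V → MvPolynomial V K) '' {v | v ∉ A})
  have hJ : ∀ i, (l i).1 ∈ PrimeSpectrum.zeroLocus (J : Set (MvPolynomial V K)) := by
    intro i
    have h₁ : P ≤ (l i).1.asIdeal := l.monotone (Fin.zero_le i)
    refine (Ideal.span_le.2 ?_ : J ≤ _)
    rintro _ ⟨v, hv, rfl⟩
    apply h₁
    simpa [A] using hv
  let l' : LTSeries (PrimeSpectrum.zeroLocus (J : Set (MvPolynomial V K))) :=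
    ⟨l.length, fun i => ⟨(l i).1, hJ i⟩, fun i => l.step i⟩
  calc ((l.length : ℕ) : WithBot ℕ∞) = l'.length := rfl
    _ ≤ Order.krullDim (PrimeSpectrum.zeroLocus (J : Set (MvPolynomial V K))) :=
      le_iSup (fun l : LTSeries _ => ((l.length : ℕ) : WithBot ℕ∞)) l'
    _ = _ := (ringKrullDim_quotient J).symm
    _ ≤ _ := ringKrullDim_quotient_span_X_compl_le K A
    _ ≤ d := by exact_mod_cast hd A hA

/-- The polynomial ring in the variables of an independent set is a quotient of `S / I(G)`. -/
theorem le_ringKrullDim_edgeIdeal (K : Type*) [Field K] {V : Type*}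
    (G : SimpleGraph V) {A : Finset V} (hA : G.IsIndepSet A) :
    (A.card : WithBot ℕ∞) ≤ ringKrullDim (MvPolynomial V K ⧸ edgeIdeal K G) := by
  classical
  let f : MvPolynomial V K →ₐ[K] MvPolynomial A K :=
    aeval fun v => if h : v ∈ A then X ⟨v, h⟩ else 0
  have hf : Function.Surjective f := by
    rw [← AlgHom.range_eq_top, eq_top_iff, ← adjoin_range_X, Algebra.adjoin_le_iff]
    rintro _ ⟨v, rfl⟩
    exact ⟨X v, by simp [f]⟩
  have hker : ∀ p ∈ edgeIdeal K G, f.toRingHom p = 0 := by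
    have : edgeIdeal K G ≤ RingHom.ker f.toRingHom := by
      refine Ideal.span_le.2 ?_
      rintro _ ⟨a, b, hab, rfl⟩
      rw [SetLike.mem_coe, RingHom.mem_ker]
      by_cases ha : a ∈ A
      · by_cases hb : b ∈ A
        · exact absurd hab (hA ha hb hab.ne)
        · simp [f, hb]
      · simp [f, ha]
    exact fun p hp => this hp
  have := ringKrullDim_le_of_surjective (Ideal.Quotient.lift _ f.toRingHom hker)
    (Ideal.Quotient.lift_surjective_of_surjective _ hker hf)
  rw [MvPolynomial.ringKrullDim_of_isNoetherianRing, ringKrullDim_eq_zero_of_field] at this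
  simpa using this

/-! ### The Hilbert series of an edge ideal -/

/-- The monomials with independent support form a basis of `S / I(G)`, degree by degree. -/
theorem finrank_quotientPiece_edgeIdeal (K : Type*) [Field K] {V : Type*} [Fintype V]
    [DecidableEq V] (G : SimpleGraph V) [DecidablePred fun A : Finset V => G.IsIndepSet A]
    (i : ℕ) :
    Module.finrank K (quotientPiece (edgeIdeal K G) i) =
      ((Finset.univ.finsuppAntidiag i).filter
        fun m : V →₀ ℕ => G.IsIndepSet (m.support : Set V)).card := by
  set M := (Finset.univ.finsuppAntidiag i).filter
    fun m : V →₀ ℕ => G.IsIndepSet (m.support : Set V) with hM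
  let b : M → MvPolynomial V K ⧸ edgeIdeal K G := fun m =>
    Ideal.Quotient.mkₐ K (edgeIdeal K G) (monomial m.1 1)
  have hdeg : ∀ m : V →₀ ℕ, m.degree = i ↔ m ∈ Finset.univ.finsuppAntidiag i := by
    intro m
    simp [Finset.mem_finsuppAntidiag, Finsupp.degree_eq_sum]
  have hli : LinearIndependent K b := by
    rw [Fintype.linearIndependent_iff]
    intro g hg m
    have hsum : ∑ m, g m • b m =
        Ideal.Quotient.mkₐ K (edgeIdeal K G) (∑ m : M, monomial m.1 (g m)) := by
      rw [map_sum]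
      refine Finset.sum_congr rfl fun m _ => ?_
      rw [← map_smul, smul_monomial, smul_eq_mul, mul_one]
    rw [hsum] at hg
    have hmem := (mem_edgeIdeal_iff G _).1 (Ideal.Quotient.eq_zero_iff_mem.1 hg)
    by_contra hne
    refine hmem m.1 ?_ (Finset.mem_filter.1 m.2).2
    rw [mem_support_iff, coeff_sum, Finset.sum_eq_single m]
    · simpa using hne
    · intro m' _ h
      rw [coeff_monomial, if_neg fun h' => h (Subtype.ext h')]
    · simp
  have hspan : quotientPiece (edgeIdeal K G) i = Submodule.span K (Set.range b) := by
    apply le_antisymm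
    · rw [quotientPiece, Submodule.map_le_iff_le_comap]
      intro p hp
      rw [Submodule.mem_comap, p.as_sum, map_sum]
      refine Submodule.sum_mem _ fun m hm => ?_
      have hmi : m ∈ Finset.univ.finsuppAntidiag i := by
        rw [← hdeg, Finsupp.degree_eq_weight_one (R := ℕ)]
        exact hp (mem_support_iff.1 hm)
      by_cases hind : G.IsIndepSet (m.support : Set V)
      · have h : monomial m (coeff m p) = coeff m p • monomial m (1 : K) := by
          rw [smul_monomial, smul_eq_mul, mul_one]
        rw [h, map_smul]
        exact Submodule.smul_mem _ _
          (Submodule.subset_span ⟨⟨m, Finset.mem_filter.2 ⟨hmi, hind⟩⟩, rfl⟩)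
      · have h : Ideal.Quotient.mk (edgeIdeal K G) (monomial m (coeff m p)) = 0 := by
          rw [Ideal.Quotient.eq_zero_iff_mem, mem_edgeIdeal_iff]
          intro m' hm'
          rw [Finset.mem_singleton.1 (support_monomial_subset hm')]
          exact hind
        simp [h]
    · rw [Submodule.span_le]
      rintro _ ⟨m, rfl⟩
      refine ⟨monomial m.1 1, ?_, rfl⟩
      exact isHomogeneous_monomial 1 ((hdeg _).2 (Finset.mem_filter.1 m.2).1)
  rw [hspan, finrank_span_eq_card hli, Fintype.card_coe]

/-- The monomials with support exactly `A` have generating function `(λ / (1 - λ)) ^ |A|`. -/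
theorem coeff_X_mul_mk_one_pow_card {V : Type*} [Fintype V] [DecidableEq V] (A : Finset V)
    (i : ℕ) :
    PowerSeries.coeff i ((PowerSeries.X * PowerSeries.mk 1 : PowerSeries ℤ) ^ A.card) =
      (((Finset.univ.finsuppAntidiag i).filter fun m : V →₀ ℕ => m.support = A).card : ℤ) := by
  have hco : ∀ k, PowerSeries.coeff k (PowerSeries.X * PowerSeries.mk 1 : PowerSeries ℤ) =
      if k ≠ 0 then 1 else 0 := by
    rintro (_ | k)
    · simp
    · simp [PowerSeries.coeff_succ_X_mul]
  rw [← Finset.prod_const, PowerSeries.coeff_prod, Finset.card_filter, Nat.cast_sum]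
  simp only [hco, Finset.prod_ite_zero, Finset.prod_const_one]
  rw [← Finset.sum_filter, ← Nat.cast_sum, ← Finset.card_filter, Finset.sum_const, nsmul_one]
  congr 2
  ext m
  simp only [Finset.mem_filter, Finset.mem_finsuppAntidiag, Finset.subset_univ, and_true]
  constructor
  · rintro ⟨⟨hsum, hsub⟩, hne⟩
    refine ⟨?_, hsub.antisymm fun a ha => Finsupp.mem_support_iff.2 (hne a ha)⟩
    rw [← hsum]
    exact (Finset.sum_subset A.subset_univ fun a _ ha =>
      Finsupp.notMem_support_iff.1 fun h => ha (hsub h)).symm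
  · rintro ⟨hsum, rfl⟩
    refine ⟨⟨?_, subset_rfl⟩, fun a => Finsupp.mem_support_iff.1⟩
    rw [← hsum]
    exact Finset.sum_subset m.support.subset_univ fun a _ ha => Finsupp.notMem_support_iff.1 ha

theorem hilbertSeries_edgeIdeal (K : Type*) [Field K] {V : Type*} [Fintype V]
    (G : SimpleGraph V) :
    hilbertSeries (edgeIdeal K G) = ∑ A ∈ indepSets G,
      (PowerSeries.X * PowerSeries.mk 1 : PowerSeries ℤ) ^ A.card := by
  classical
  ext i
  rw [hilbertSeries, PowerSeries.coeff_mk, finrank_quotientPiece_edgeIdeal, map_sum]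
  simp only [coeff_X_mul_mk_one_pow_card]
  rw [← Nat.cast_sum, Finset.card_eq_sum_card_fiberwise (f := Finsupp.support)
    (t := indepSets G)]
  · refine congrArg _ (Finset.sum_congr rfl fun A hA => congrArg _ ?_)
    ext m
    rw [mem_indepSets] at hA
    simp only [Finset.mem_filter]
    constructor
    · exact fun h => ⟨h.1.1, h.2⟩
    · exact fun h => ⟨⟨h.1, h.2 ▸ hA⟩, h.2⟩
  · intro m hm
    simpa using (Finset.mem_filter.1 hm).2

end

section

open Polynomial

/-- With `d` the independence number, the `h`-polynomial is `∑ λ ^ |A| (1 - λ) ^ (d - |A|)` over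
the independent sets `A`. -/
theorem isHPolynomial_edgeIdeal (K : Type*) [Field K] {V : Type*} [Fintype V]
    (G : SimpleGraph V) {d : ℕ}
    (hle : ∀ A : Finset V, G.IsIndepSet A → A.card ≤ d)
    (hdim : ringKrullDim (MvPolynomial V K ⧸ edgeIdeal K G) = d) :
    IsHPolynomial (edgeIdeal K G) (∑ A ∈ indepSets G,
      (X : ℤ[X]) ^ A.card * (1 - X) ^ (d - A.card)) := by
  refine ⟨d, hdim, ?_⟩
  rw [hilbertSeries_edgeIdeal, Finset.mul_sum, ← Polynomial.coeToPowerSeries.ringHom_apply,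
    map_sum]
  refine Finset.sum_congr rfl fun A hA => ?_
  have hA' := hle A (mem_indepSets.1 hA)
  have h1 : (1 - PowerSeries.X : PowerSeries ℤ) ^ d =
      (1 - PowerSeries.X) ^ (d - A.card) * (1 - PowerSeries.X) ^ A.card := by
    rw [← pow_add, Nat.sub_add_cancel hA']
  have h2 : (1 - PowerSeries.X : PowerSeries ℤ) ^ A.card *
      (PowerSeries.X * PowerSeries.mk 1) ^ A.card = PowerSeries.X ^ A.card := by
    rw [← mul_pow, mul_left_comm, mul_comm (1 - PowerSeries.X),
      PowerSeries.mk_one_mul_one_sub_eq_one, mul_one]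
  rw [h1, mul_assoc, h2]
  simp [mul_comm]

/-- The coefficient of `λ ^ d` is `∑ (-1) ^ (d - |A|)` over the independent sets `A`, which has the
parity of their number. -/
theorem degree_sum_X_pow_mul_one_sub_X_pow {ι : Type*} {s : Finset ι} (hs : Odd s.card)
    {f : ι → ℕ} {d : ℕ} (hle : ∀ i ∈ s, f i ≤ d) :
    (∑ i ∈ s, (X : ℤ[X]) ^ f i * (1 - X) ^ (d - f i)).degree = (d : WithBot ℕ) := by
  have hdeg : ∀ k, ((1 - X : ℤ[X]) ^ k).natDegree ≤ k := fun k => by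
    have h : (1 - X : ℤ[X]).natDegree ≤ 1 := by compute_degree
    simpa using natDegree_pow_le_of_le k h
  apply le_antisymm
  · refine (degree_sum_le _ _).trans (Finset.sup_le fun i hi => ?_)
    rw [← natDegree_le_iff_degree_le]
    refine natDegree_mul_le.trans ?_
    have := hdeg (d - f i)
    have := hle i hi
    simp only [natDegree_X_pow]
    omega
  · apply le_degree_of_ne_zero
    intro h0
    have hc : ∀ k, coeff ((1 - X : ℤ[X]) ^ k) k = (-1) ^ k := fun k => by
      have h := coeff_pow_of_natDegree_le (p := (1 - X : ℤ[X])) (m := k) (n := 1)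
        (by compute_degree)
      rw [mul_one] at h
      rw [h]
      simp [coeff_one, coeff_X]
    have h1 := congrArg (Int.cast : ℤ → ZMod 2) h0
    rw [finsetSum_coeff, Int.cast_sum, Finset.sum_congr rfl (g := fun _ => (1 : ZMod 2))] at h1
    · rw [Finset.sum_const, nsmul_one, Int.cast_zero, ZMod.natCast_eq_zero_iff_even] at h1
      exact (Nat.not_even_iff_odd.2 hs) h1
    · intro i hi
      rw [coeff_X_pow_mul', if_pos (hle i hi), hc]
      have : (-1 : ZMod 2) = 1 := by decide
      simp [this]

end

/-! ### Independent sets of a Cameron–Walker graph -/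

theorem SimpleGraph.Iso.isIndepSet_map {V W : Type*} {G : SimpleGraph V} {H : SimpleGraph W}
    (e : G ≃g H) {A : Finset V} (hA : G.IsIndepSet (A : Set V)) :
    H.IsIndepSet (A.map e.toEquiv.toEmbedding : Set W) := by
  intro a ha b hb hne hab
  simp only [Finset.coe_map, Set.mem_image, Finset.mem_coe] at ha hb
  obtain ⟨a, ha, rfl⟩ := ha
  obtain ⟨b, hb, rfl⟩ := hb
  exact hA ha hb (fun h => hne (h ▸ rfl)) (e.map_adj_iff.1 hab)

theorem SimpleGraph.Iso.card_indepSets_eq {V W : Type*} [Fintype V] [Fintype W]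
    {G : SimpleGraph V} {H : SimpleGraph W} (e : G ≃g H) :
    (indepSets G).card = (indepSets H).card := by
  refine Finset.card_nbij' (fun A => A.map e.toEquiv.toEmbedding)
    (fun A => A.map e.symm.toEquiv.toEmbedding) ?_ ?_ ?_ ?_
  · exact fun A hA => mem_indepSets.2 (e.isIndepSet_map (mem_indepSets.1 hA))
  · exact fun A hA => mem_indepSets.2 (e.symm.isIndepSet_map (mem_indepSets.1 hA))
  · intro A _
    ext a
    rw [Finset.mem_map_equiv, Finset.mem_map_equiv]
    exact iff_of_eq (congrArg (· ∈ A) (e.symm_apply_apply a))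
  · intro A _
    ext a
    rw [Finset.mem_map_equiv, Finset.mem_map_equiv]
    exact iff_of_eq (congrArg (· ∈ A) (e.apply_symm_apply a))

theorem Finset.even_card_of_involution {α : Type*} {s : Finset α} (g : α → α)
    (hmem : ∀ a ∈ s, g a ∈ s) (hne : ∀ a ∈ s, g a ≠ a) (hinv : ∀ a ∈ s, g (g a) = a) :
    Even s.card := by
  rw [← ZMod.natCast_eq_zero_iff_even, ← nsmul_one, ← Finset.sum_const]
  exact Finset.sum_involution (fun a _ => g a) (fun _ _ => by decide) (fun a ha _ => hne a ha)
    hmem hinv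

namespace CWVertex

variable {m n : ℕ} {s : Fin m → ℕ} {t : Fin n → ℕ}

instance : Finite (CWVertex s t) := by
  let f : CWVertex s t → ((Σ i, Fin (s i)) ⊕ Fin m) ⊕ (Fin n ⊕ (Σ j, Fin (t j) × Fin 2))
    | x i k => Sum.inl (Sum.inl ⟨i, k⟩)
    | v i => Sum.inl (Sum.inr i)
    | w j => Sum.inr (Sum.inl j)
    | y j l b => Sum.inr (Sum.inr ⟨j, l, b⟩)
  refine Finite.of_injective f ?_
  rintro (_ | _ | _ | _) (_ | _ | _ | _) h <;> simp_all [f]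
  obtain ⟨rfl, h⟩ := h
  simpa using h

/-- The involution of the vertices exchanging the two free vertices of each pendant triangle. -/
def swap : CWVertex s t → CWVertex s t
  | y j l b => y j l b.rev
  | a => a

theorem swap_swap (a : CWVertex s t) : swap (swap a) = a := by
  cases a <;> simp [swap]

/-- A vertex is sent to the star of some `v i` (coded by the leaves at `v i`) or to the bouquet of
triangles at some `w j` (coded by those triangles, or by one point if there are none). The vertices
with a given image are pairwise adjacent. -/
def toCell (hs : ∀ i, 1 ≤ s i) :
    CWVertex s t → (Σ i, Fin (s i)) ⊕ (Σ j, Fin (max (t j) 1))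
  | x i k => Sum.inl ⟨i, k⟩
  | v i => Sum.inl ⟨i, ⟨0, hs i⟩⟩
  | w j => Sum.inr ⟨j, ⟨0, by omega⟩⟩
  | y j l _ => Sum.inr ⟨j, ⟨l, by omega⟩⟩

/-- A section of `toCell` with independent image. -/
def ofCell : (Σ i, Fin (s i)) ⊕ (Σ j, Fin (max (t j) 1)) → CWVertex s t
  | Sum.inl ⟨i, k⟩ => x i k
  | Sum.inr ⟨j, l⟩ => if h : l < t j then y j ⟨l, h⟩ 0 else w j

theorem toCell_ofCell (hs : ∀ i, 1 ≤ s i) (c : (Σ i, Fin (s i)) ⊕ (Σ j, Fin (max (t j) 1))) :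
    toCell hs (ofCell c) = c := by
  rcases c with ⟨i, k⟩ | ⟨j, l⟩
  · rfl
  · simp only [ofCell]
    split_ifs with h
    · rfl
    · simp only [toCell, Sum.inr.injEq, Sigma.mk.injEq, heq_eq_eq, true_and, Fin.ext_iff]
      have := l.isLt
      omega

end CWVertex

section

open CWVertex

variable {m n : ℕ} {s : Fin m → ℕ} {t : Fin n → ℕ} {B : SimpleGraph (Fin m ⊕ Fin n)}

theorem CWEdge.adj {a b : CWVertex s t} (h : CWEdge s t B a b) :
    (cameronWalkerGraph s t B).Adj a b := by
  refine (SimpleGraph.fromRel_adj _ _ _).2 ⟨?_, Or.inl h⟩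
  cases h <;> simp

theorem cameronWalkerGraph_adj_iff {a b : CWVertex s t} :
    (cameronWalkerGraph s t B).Adj a b ↔ CWEdge s t B a b ∨ CWEdge s t B b a :=
  ⟨fun h => ((SimpleGraph.fromRel_adj _ _ _).1 h).2,
    fun h => h.elim CWEdge.adj fun h => h.adj.symm⟩

theorem adj_y_rev (j : Fin n) (l : Fin (t j)) (b : Fin 2) :
    (cameronWalkerGraph s t B).Adj (y j l b) (y j l b.rev) := by
  fin_cases b
  · exact (CWEdge.base j l).adj
  · exact (CWEdge.base j l).adj.symm

theorem eq_v_of_adj_x {i : Fin m} {k : Fin (s i)} {b : CWVertex s t}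
    (h : (cameronWalkerGraph s t B).Adj (x i k) b) : b = v i := by
  rcases cameronWalkerGraph_adj_iff.1 h with h | h <;> cases h
  rfl

/-- `CWVertex.swap` as a graph automorphism. -/
def swapIso : cameronWalkerGraph s t B ≃g cameronWalkerGraph s t B where
  toEquiv := ⟨swap, swap, swap_swap, swap_swap⟩
  map_rel_iff' := by
    have key : ∀ a b : CWVertex s t, (cameronWalkerGraph s t B).Adj a b →
        (cameronWalkerGraph s t B).Adj (swap a) (swap b) := by
      have edge : ∀ a b : CWVertex s t, CWEdge s t B a b →
          (cameronWalkerGraph s t B).Adj (swap a) (swap b) := by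
        intro a b h
        cases h with
        | bipartite i j h => exact (CWEdge.bipartite i j h).adj
        | leaf i k => exact (CWEdge.leaf i k).adj
        | side j l b => exact (CWEdge.side j l b.rev).adj
        | base j l => exact (CWEdge.base j l).adj.symm
      intro a b h
      rcases cameronWalkerGraph_adj_iff.1 h with h | h
      · exact edge a b h
      · exact (edge b a h).symm
    intro a b
    refine ⟨fun h => ?_, key a b⟩
    simpa only [Equiv.coe_fn_mk, swap_swap] using key _ _ h

theorem adj_of_toCell_eq (hs : ∀ i, 1 ≤ s i) {a b : CWVertex s t} (hne : a ≠ b)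
    (h : toCell hs a = toCell hs b) : (cameronWalkerGraph s t B).Adj a b := by
  have hy : ∀ b c : Fin 2, b ≠ c → c = b.rev := by decide
  rcases a with ⟨i, k⟩ | i | j | ⟨j, l, c⟩ <;> rcases b with ⟨i', k'⟩ | i' | j' | ⟨j', l', c'⟩ <;>
    simp only [toCell, reduceCtorEq, Sum.inl.injEq, Sum.inr.injEq, Sigma.mk.injEq] at h <;>
    obtain ⟨rfl, h⟩ := h <;> simp only [heq_eq_eq, Fin.ext_iff] at h
  · exact absurd (by rw [Fin.ext h]) hne
  · exact (CWEdge.leaf _ _).adj.symm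
  · exact (CWEdge.leaf _ _).adj
  · exact absurd rfl hne
  · exact absurd rfl hne
  · exact (CWEdge.side _ _ _).adj
  · exact (CWEdge.side _ _ _).adj.symm
  · obtain rfl := Fin.ext h
    rw [hy c c' fun h => hne (h ▸ rfl)]
    exact adj_y_rev _ _ _

theorem ne_of_edge_y {j j' : Fin n} {l : Fin (t j)} {l' : Fin (t j')} {c c' : Fin 2}
    (h : CWEdge s t B (y j l c) (y j' l' c')) : c ≠ c' := by
  cases h
  decide

/-- `toCell` is injective on independent sets. -/
theorem card_le_of_isIndepSet (hs : ∀ i, 1 ≤ s i) {A : Finset (CWVertex s t)}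
    (hA : (cameronWalkerGraph s t B).IsIndepSet (A : Set (CWVertex s t))) :
    A.card ≤ (∑ i, s i) + ∑ j, max (t j) 1 := by
  have h := Finset.card_le_card_of_injOn (toCell hs) (t := Finset.univ)
    (fun a _ => Finset.mem_coe.2 (Finset.mem_univ _)) (s := A) fun a ha b hb hab => by
      by_contra hne
      exact hA ha hb hne (adj_of_toCell_eq hs hne hab)
  simpa using h

theorem exists_isIndepSet_card_eq (hs : ∀ i, 1 ≤ s i) :
    ∃ A : Finset (CWVertex s t),
      (cameronWalkerGraph s t B).IsIndepSet (A : Set (CWVertex s t)) ∧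
        A.card = (∑ i, s i) + ∑ j, max (t j) 1 := by
  refine ⟨Finset.univ.map ⟨ofCell, Function.LeftInverse.injective (toCell_ofCell hs)⟩, ?_, by simp⟩
  have key : ∀ c c' : (Σ i, Fin (s i)) ⊕ (Σ j, Fin (max (t j) 1)),
      ¬ CWEdge s t B (ofCell c) (ofCell c') := by
    rintro (⟨i, k⟩ | ⟨j, l⟩) (⟨i', k'⟩ | ⟨j', l'⟩) h
    · cases h
    · simp only [ofCell] at h
      split_ifs at h <;> cases h
    · simp only [ofCell] at h
      split_ifs at h <;> cases h
    · simp only [ofCell] at h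
      split_ifs at h
      · exact ne_of_edge_y h rfl
      · cases h
      · cases h
        omega
      · cases h
  intro a ha b hb _ hab
  simp only [Finset.coe_map, Finset.coe_univ, Set.image_univ, Set.mem_range,
    Function.Embedding.coeFn_mk] at ha hb
  obtain ⟨c, rfl⟩ := ha
  obtain ⟨c', rfl⟩ := hb
  exact (cameronWalkerGraph_adj_iff.1 hab).elim (key c c') (key c' c)

/-- Toggling a leaf at some `v i ∉ A` is an involution on the independent sets `A` missing
some `v i`. -/
theorem even_card_indepSets_missing [Fintype (CWVertex s t)] (hs : ∀ i, 1 ≤ s i)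
    [DecidablePred fun A : Finset (CWVertex s t) => ∀ i, v i ∈ A] :
    Even ((indepSets (cameronWalkerGraph s t B)).filter fun A => ¬ ∀ i, v i ∈ A).card := by
  classical
  rcases isEmpty_or_nonempty (Fin m) with hm | hm
  · simp
  obtain ⟨c, hc⟩ : ∃ c : Set (Fin m) → Fin m, ∀ S, S.Nonempty → c S ∈ S :=
    ⟨fun S => if h : S.Nonempty then h.some else Classical.arbitrary _,
      fun S h => by simpa [h] using h.some_mem⟩
  let u : Fin m → CWVertex s t := fun i => x i ⟨0, hs i⟩
  let S : Finset (CWVertex s t) → Set (Fin m) := fun A => {i | v i ∉ A}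
  let g : Finset (CWVertex s t) → Finset (CWVertex s t) := fun A => symmDiff A {u (c (S A))}
  have hv : ∀ A i, v i ∈ g A ↔ v i ∈ A := by
    intro A i
    simp [g, u, Finset.mem_symmDiff]
  -- The chosen index depends only on the vertices `v i` in `A`, which toggling a leaf preserves.
  have hS : ∀ A, S (g A) = S A := fun A => Set.ext fun i => not_congr (hv A i)
  refine Finset.even_card_of_involution g ?_ ?_ ?_
  · intro A hA
    obtain ⟨hA, hmiss⟩ := Finset.mem_filter.1 hA
    rw [mem_indepSets] at hA
    refine Finset.mem_filter.2 ⟨mem_indepSets.2 ?_, by simpa only [hv] using hmiss⟩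
    have hcA : v (c (S A)) ∉ g A := by
      rw [hv]
      exact hc (S A) (not_forall.1 hmiss)
    have hsub : ∀ a ∈ g A, a ∈ A ∨ a = u (c (S A)) := by
      intro a ha
      simp only [g, Finset.mem_symmDiff, Finset.mem_singleton] at ha
      tauto
    intro a ha b hb hne hab
    rcases hsub a ha with ha' | rfl
    · rcases hsub b hb with hb' | rfl
      · exact hA ha' hb' hne hab
      · exact hcA (eq_v_of_adj_x hab.symm ▸ ha)
    · exact hcA (eq_v_of_adj_x hab ▸ hb)
  · intro A _ h
    simp only [g, symmDiff_eq_left] at h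
    simp at h
  · intro A _
    change symmDiff (g A) {u (c (S (g A)))} = A
    rw [hS]
    exact symmDiff_symmDiff_cancel_right _ _

/-- Among the independent sets containing every `v i`, which contain no leaf and no `w j`, the only
one fixed by the exchange of the free triangle vertices is `{v i}` itself. -/
theorem odd_card_indepSets_full [Fintype (CWVertex s t)]
    (hw : ∀ j, ∃ i, B.Adj (Sum.inl i) (Sum.inr j))
    [DecidablePred fun A : Finset (CWVertex s t) => ∀ i, v i ∈ A] :
    Odd ((indepSets (cameronWalkerGraph s t B)).filter fun A => ∀ i, v i ∈ A).card := by
  classical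
  set F := (indepSets (cameronWalkerGraph s t B)).filter fun A => ∀ i, v i ∈ A
  let A₀ : Finset (CWVertex s t) := Finset.univ.image v
  let g : Finset (CWVertex s t) → Finset (CWVertex s t) := fun A =>
    A.map (swapIso (B := B)).toEquiv.toEmbedding
  have hmem_g : ∀ A a, a ∈ g A ↔ swap a ∈ A := by
    intro A a
    simp only [g, Finset.mem_map_equiv]
    rfl
  have hgg : ∀ A, g (g A) = A := fun A => by
    ext a
    rw [hmem_g, hmem_g, swap_swap]
  have hA₀ : A₀ ∈ F := by
    refine Finset.mem_filter.2 ⟨mem_indepSets.2 ?_, by simp [A₀]⟩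
    intro a ha b hb _ hab
    simp only [A₀, Finset.coe_image, Finset.coe_univ, Set.image_univ, Set.mem_range] at ha hb
    obtain ⟨i, rfl⟩ := ha
    obtain ⟨i', rfl⟩ := hb
    rcases cameronWalkerGraph_adj_iff.1 hab with h | h <;> cases h
  have hfix : ∀ A ∈ F, g A = A → A = A₀ := by
    intro A hA hgA
    obtain ⟨hA, hv⟩ := Finset.mem_filter.1 hA
    rw [mem_indepSets] at hA
    apply Finset.Subset.antisymm
    · intro a ha
      rcases a with ⟨i, k⟩ | i | j | ⟨j, l, b⟩
      · exact absurd (CWEdge.leaf i k).adj (hA (hv i) ha (by simp))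
      · simp [A₀]
      · obtain ⟨i, hij⟩ := hw j
        exact absurd (CWEdge.bipartite i j hij).adj (hA (hv i) ha (by simp))
      · have ha' : y j l b.rev ∈ A := (hmem_g A (y j l b)).1 (hgA.symm ▸ ha)
        exact absurd (adj_y_rev j l b) (hA ha ha' (adj_y_rev (s := s) (B := B) j l b).ne)
    · intro a ha
      obtain ⟨i, _, rfl⟩ := Finset.mem_image.1 ha
      exact hv i
  have hgF : ∀ A ∈ F, g A ∈ F := by
    intro A hA
    obtain ⟨hA, hv⟩ := Finset.mem_filter.1 hA
    exact Finset.mem_filter.2 ⟨mem_indepSets.2 (swapIso.isIndepSet_map (mem_indepSets.1 hA)),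
      fun i => (hmem_g A (v i)).2 (hv i)⟩
  have hgA₀ : g A₀ = A₀ := by
    ext a
    rw [hmem_g]
    cases a <;> simp [swap, A₀]
  have heven : Even (F.erase A₀).card := by
    refine Finset.even_card_of_involution g ?_ ?_ fun A _ => hgg A
    · intro A hA
      obtain ⟨hne, hA⟩ := Finset.mem_erase.1 hA
      exact Finset.mem_erase.2 ⟨fun h => hne (by rw [← hgg A, h, hgA₀]), hgF A hA⟩
    · intro A hA h
      obtain ⟨hne, hA⟩ := Finset.mem_erase.1 hA
      exact hne (hfix A hA h)
  rw [← Finset.card_erase_add_one hA₀]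
  exact heven.add_one

/-- The parity of the number of independent sets
decides that the `h`-polynomial has the largest possible degree, see `degree_sum_X_pow_mul_one_sub_X_pow`. -/
theorem odd_card_indepSets_cameronWalkerGraph [Fintype (CWVertex s t)] (hs : ∀ i, 1 ≤ s i)
    (hw : ∀ j, ∃ i, B.Adj (Sum.inl i) (Sum.inr j)) :
    Odd (indepSets (cameronWalkerGraph s t B)).card := by
  classical
  rw [← Finset.card_filter_add_card_filter_not (fun A => ∀ i, v i ∈ A)]
  exact (odd_card_indepSets_full hw).add_even (even_card_indepSets_missing hs)

end

theorem exists_adj_inl_inr {m n : ℕ} (hm : 1 ≤ m) {B : SimpleGraph (Fin m ⊕ Fin n)}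
    (hB : B.Connected) (hBip : B.IsBipartiteWith (Set.range Sum.inl) (Set.range Sum.inr))
    (j : Fin n) : ∃ i, B.Adj (Sum.inl i) (Sum.inr j) := by
  have : Nontrivial (Fin m ⊕ Fin n) :=
    ⟨⟨Sum.inl ⟨0, hm⟩, Sum.inr j, by simp⟩⟩
  obtain ⟨a, ha⟩ := hB.preconnected.exists_adj_of_nontrivial (Sum.inr j)
  rcases hBip.mem_of_adj ha with ⟨⟨_, h⟩, _⟩ | ⟨_, ⟨i, rfl⟩⟩
  · cases h
  · exact ⟨i, ha.symm⟩

/-! ### The degree of the `h`-polynomial -/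

theorem mainTheorem1 {K : Type*} [Field K] {V : Type*} (G : SimpleGraph V)
    {m n : ℕ} (hm : 1 ≤ m) (hn : 1 ≤ n)
    (s : Fin m → ℕ) (hs : ∀ i, 1 ≤ s i) (t : Fin n → ℕ)
    (B : SimpleGraph (Fin m ⊕ Fin n)) (hB : B.Connected)
    (hBip : B.IsBipartiteWith (Set.range Sum.inl) (Set.range Sum.inr))
    (e : G ≃g cameronWalkerGraph s t B) :
    ringKrullDim (MvPolynomial V K ⧸ edgeIdeal K G)
        = (((∑ i, s i) + (∑ j, max (t j) 1) : ℕ) : WithBot ℕ∞) ∧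
      ∃ h : Polynomial ℤ, IsHPolynomial (edgeIdeal K G) h ∧
        h.degree = (((∑ i, s i) + (∑ j, max (t j) 1) : ℕ) : WithBot ℕ) := by
  have := Fintype.ofFinite (CWVertex s t)
  have := Fintype.ofEquiv _ e.toEquiv.symm
  have hle : ∀ A : Finset V, G.IsIndepSet (A : Set V) →
      A.card ≤ (∑ i, s i) + ∑ j, max (t j) 1 := fun A hA => by
    simpa using card_le_of_isIndepSet hs (e.isIndepSet_map hA)
  obtain ⟨A, hA, hcard⟩ := exists_isIndepSet_card_eq (t := t) (B := B) hs
  have hdim : ringKrullDim (MvPolynomial V K ⧸ edgeIdeal K G)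
      = (((∑ i, s i) + (∑ j, max (t j) 1) : ℕ) : WithBot ℕ∞) := by
    refine le_antisymm (ringKrullDim_edgeIdeal_le K G hle) ?_
    have := le_ringKrullDim_edgeIdeal K G (e.symm.isIndepSet_map hA)
    rwa [Finset.card_map, hcard] at this
  refine ⟨hdim, _, isHPolynomial_edgeIdeal K G hle hdim,
    degree_sum_X_pow_mul_one_sub_X_pow ?_ fun A hA => hle A (mem_indepSets.1 hA)⟩
  rw [e.card_indepSets_eq]
  exact odd_card_indepSets_cameronWalkerGraph hs (exists_adj_inl_inr hm hB hBip)
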